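/- Let $\mathbb D=\{z\in\mathbb C:|z|<1\}$ and let $\mathrm{Hol}(\mathbb D)$ be the Fréchet space of holomorphic functions on $\mathbb D$ with the topology of uniform convergence on compact subsets. Let $\varphi$ be a Schröder map, i.e. a holomorphic map $\varphi:\mathbb D\to\mathbb D$ which is not an automorphism of $\mathbb D$ and for which there is $\alpha\in\mathbb D$ with $\varphi(\alpha)=\alpha$ and $\varphi'(\alpha)\neq 0$. Put $\lambda_n=\varphi'(\alpha)^n$ for $n=0,1,2,\dots$, and $C_\varphi f=f\circ\varphi$ for $f\in\mathrm{Hol}(\mathbb D)$. Let $X\hookrightarrow\mathrm{Hol}(\mathbb D)$ be an infinite-dimensional complex Banach space which is a subspace of $\mathrm{Hol}(\mathbb D)$ with continuous inclusion and satisfies $C_\varphi X\subset X$. Let $T=C_\varphi|_X$, which is a bounded operator on $X$ by the closed graph theorem. Then $0\in\sigma(T)$. Let $\sigma_0(T)$ be the connected component of $0$ in $\sigma(T)$, and let $J_0$ be the set of all integers $n\ge 0$ such that $\lambda_n$ is an isolated point of $\sigma(T)$. Then $$\sigma(T)=\sigma_0(T)\cup\{\lambda_n:n\in J_0\},$$ and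 $\sigma_0(T)=\sigma_e(T)$, the essential spectrum of $T$. Here $\sigma_e(T)$ is the set of all $\mu\in\sigma(T)$ that are not Riesz points. A point $\mu\in\sigma(T)$ is a Riesz point if it is isolated in $\sigma(T)$ and $X=Y_1\oplus Y_2$ with closed $T$-invariant subspaces $Y_1,Y_2$ such that $\dim Y_1<\infty$, $\sigma(T|_{Y_1})=\{\mu\}$, and $(\mu\,\mathrm{Id}-T)|_{Y_2}$ is invertible on $Y_2$. -/

import Mathlib

open Set Topology

/-- The open unit disc in the complex plane. -/
abbrev Disc : Set ℂ := Metric.ball (0 : ℂ) 1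

/-- The space `Hol(𝔻)` of holomorphic functions on the open unit disc. As a subspace of `C(𝔻, ℂ)` it
carries the compact-open topology, that is, the topology of uniform convergence on the compact
subsets of the disc. -/
def Hol : Submodule ℂ C(Disc, ℂ) where
  carrier := {f | ∃ F : ℂ → ℂ, DifferentiableOn ℂ F Disc ∧ ∀ z : Disc, f z = F z}
  add_mem' := by
    rintro f g ⟨F, hF, hfF⟩ ⟨G, hG, hgG⟩
    exact ⟨F + G, hF.add hG, fun z => by simp [hfF z, hgG z]⟩
  zero_mem' := ⟨0, differentiableOn_const 0, fun z => by simp⟩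
  smul_mem' := by
    rintro c f ⟨F, hF, hfF⟩
    exact ⟨c • F, hF.const_smul c, fun z => by simp [hfF z]⟩

/-- `φ` restricts to a holomorphic self-map of the open unit disc. -/
structure IsHolSelfMap (φ : ℂ → ℂ) : Prop where
  differentiableOn : DifferentiableOn ℂ φ Disc
  mapsTo : MapsTo φ Disc Disc

/-- `φ` restricts to an automorphism of the disc: a holomorphic self-map of the disc
with a holomorphic inverse. -/
def IsDiscAut (φ : ℂ → ℂ) : Prop :=
  IsHolSelfMap φ ∧ ∃ ψ : ℂ → ℂ, IsHolSelfMap ψ ∧ (∀ z ∈ Disc, ψ (φ z) = z) ∧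
    ∀ z ∈ Disc, φ (ψ z) = z

/-- `φ` is a Schröder map with interior fixed point `α`: a holomorphic self-map of the disc which
is not an automorphism, which fixes `α` in the disc and whose derivative at `α` is not zero. -/
structure IsSchroderMap (φ : ℂ → ℂ) (α : ℂ) : Prop extends IsHolSelfMap φ where
  not_aut : ¬ IsDiscAut φ
  mem_disc : α ∈ Disc
  fixed : φ α = α
  deriv_ne_zero : deriv φ α ≠ 0

/-- A holomorphic self-map of the disc as a continuous self-map of the subtype. -/
def IsHolSelfMap.toContinuousMap {φ : ℂ → ℂ} (hφ : IsHolSelfMap φ) : C(Disc, Disc) where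
  toFun := hφ.mapsTo.restrict
  continuous_toFun := hφ.differentiableOn.continuousOn.mapsToRestrict hφ.mapsTo

/-- The composition operator `C_φ f = f ∘ φ` on `Hol(𝔻)`. -/
noncomputable def compHol {φ : ℂ → ℂ} (hφ : IsHolSelfMap φ) : Hol →L[ℂ] Hol where
  toFun f := ⟨(f : C(Disc, ℂ)).comp hφ.toContinuousMap, by
    obtain ⟨F, hF, hfF⟩ := f.2
    exact ⟨F ∘ φ, hF.comp hφ.differentiableOn hφ.mapsTo, fun z => hfF _⟩⟩
  map_add' _ _ := rfl
  map_smul' _ _ := rfl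
  cont := by
    refine Continuous.subtype_mk ?_ _
    exact (ContinuousMap.continuous_precomp hφ.toContinuousMap).comp continuous_subtype_val

theorem compHol_apply {φ : ℂ → ℂ} (hφ : IsHolSelfMap φ) (f : Hol) (z : Disc) :
    (compHol hφ f : C(Disc, ℂ)) z = (f : C(Disc, ℂ)) ⟨φ z, hφ.mapsTo z.2⟩ := rfl

section Restriction

variable {X : Type*} [NormedAddCommGroup X] [NormedSpace ℂ X]

/-- The space `X`, embedded in `Hol(𝔻)` by `ι`, is invariant under `C_φ`. -/
def IsCompInvariant {φ : ℂ → ℂ} (hφ : IsHolSelfMap φ) (ι : X →L[ℂ] Hol) : Prop :=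
  ∀ x : X, ∃ y : X, ι y = compHol hφ (ι x)

/-- The restriction of `C_φ` to an invariant space `X`, as a linear map. -/
noncomputable def compRestrictLin {φ : ℂ → ℂ} (hφ : IsHolSelfMap φ) (ι : X →L[ℂ] Hol)
    (hι : Function.Injective ι) (hinv : IsCompInvariant hφ ι) : X →ₗ[ℂ] X where
  toFun x := (hinv x).choose
  map_add' x y := hι <| (hinv (x + y)).choose_spec.trans <| by
    rw [map_add, map_add, map_add]
    exact congrArg₂ _ (hinv x).choose_spec.symm (hinv y).choose_spec.symm
  map_smul' c x := hι <| (hinv (c • x)).choose_spec.trans <| by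
    rw [map_smul, map_smul, RingHom.id_apply, map_smul]
    exact congrArg _ (hinv x).choose_spec.symm

theorem compRestrictLin_spec {φ : ℂ → ℂ} (hφ : IsHolSelfMap φ) (ι : X →L[ℂ] Hol)
    (hι : Function.Injective ι) (hinv : IsCompInvariant hφ ι) (x : X) :
    ι (compRestrictLin hφ ι hι hinv x) = compHol hφ (ι x) :=
  (hinv x).choose_spec

/-- The restriction `T` of `C_φ` to an invariant Banach space `X`; it is a bounded operator by the
closed graph theorem. -/
noncomputable def compRestrict [CompleteSpace X] {φ : ℂ → ℂ} (hφ : IsHolSelfMap φ)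
    (ι : X →L[ℂ] Hol) (hι : Function.Injective ι) (hinv : IsCompInvariant hφ ι) : X →L[ℂ] X :=
  ContinuousLinearMap.ofIsClosedGraph (g := compRestrictLin hφ ι hι hinv) <| by
    have h : ((compRestrictLin hφ ι hι hinv).graph : Set (X × X)) =
        {p | ι p.2 = compHol hφ (ι p.1)} := by
      ext p
      rw [SetLike.mem_coe, LinearMap.mem_graph_iff, mem_ofPred_eq,
        ← compRestrictLin_spec hφ ι hι hinv, hι.eq_iff]
    rw [h]
    exact isClosed_eq (ι.continuous.comp continuous_snd)
      ((compHol hφ).continuous.comp (ι.continuous.comp continuous_fst))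

theorem compRestrict_spec [CompleteSpace X] {φ : ℂ → ℂ} (hφ : IsHolSelfMap φ)
    (ι : X →L[ℂ] Hol) (hι : Function.Injective ι) (hinv : IsCompInvariant hφ ι) (x : X) :
    ι (compRestrict hφ ι hι hinv x) = compHol hφ (ι x) :=
  compRestrictLin_spec hφ ι hι hinv x

end Restriction

/-- `x` is an isolated point of the set `s`. -/
def IsIsolatedPt (s : Set ℂ) (x : ℂ) : Prop :=
  x ∈ s ∧ ∃ U ∈ 𝓝 x, U ∩ s ⊆ {x}

section Riesz

variable {X : Type*} [NormedAddCommGroup X] [NormedSpace ℂ X]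

/-- `μ` is a Riesz point of `S`: it is an isolated point of the spectrum, and `X` is the direct sum
of two closed `S`-invariant subspaces `Y₁` and `Y₂` such that `Y₁` is finite-dimensional, the
restriction of `S` to `Y₁` has spectrum `{μ}`, and the restriction of `μ - S` to `Y₂` is
invertible. -/
def IsRieszPoint (S : X →L[ℂ] X) (μ : ℂ) : Prop :=
  IsIsolatedPt (spectrum ℂ S) μ ∧
    ∃ (Y₁ Y₂ : Submodule ℂ X) (h₁ : MapsTo S Y₁ Y₁) (h₂ : MapsTo S Y₂ Y₂),
      IsCompl Y₁ Y₂ ∧ IsClosed (Y₁ : Set X) ∧ IsClosed (Y₂ : Set X) ∧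
      FiniteDimensional ℂ Y₁ ∧
      spectrum ℂ (S.restrict h₁ : Y₁ →L[ℂ] Y₁) = {μ} ∧
      IsUnit (algebraMap ℂ (Y₂ →L[ℂ] Y₂) μ - S.restrict h₂)

/-- The essential spectrum: the points of the spectrum that are not Riesz points. -/
def essSpectrum (S : X →L[ℂ] X) : Set ℂ :=
  {μ | μ ∈ spectrum ℂ S ∧ ¬ IsRieszPoint S μ}

end Riesz

/-! ### Filling holes of the resolvent set through an injective intertwiner. -/

section Transfer

/-! Let `W n` be the space of elements of `X` vanishing to order at least `n` at `α`, and `λ =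
φ'(α)`. Each `W n` is closed, invariant and of finite codimension, and `T` acts as `λ ^ n` on `W n /
W (n + 1)`. By the Schwarz lemma `0 < |λ| < 1`, and on a small closed ball about `α` the operator
contracts the sup norm on `W n` by a factor `ρ ^ n`, with `ρ < 1` (`isKoenigsFiltration`).

The norm of `X` may be much stronger than this sup norm, so the contraction does not bound the
spectrum of `T` on `W N`. It does fill holes: if a bounded open set has its closure in `|z| > ρ ^ N`
and its frontier in the resolvent set of `T` on `W N`, the whole set lies in that resolvent set
(`subset_resolventSet_of_intertwining`, by a vector-valued maximum principle). Hence for a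
relatively clopen part `U` of the spectrum missing `0` and `N` large, `z - T` is bijective on `W N`
for all `z` in `U`. Only the finite-dimensional quotient `X / W N`, with eigenvalues `λ ^ m`, `m <
N`, can then contribute, so `U` consists of powers of `λ` that are Riesz points
(`exists_eq_pow_and_isRieszPoint`). The component of `0` is the intersection of the clopen sets
containing `0`, so this covers every point outside it.

Conversely, `T` cannot be invertible on an infinite-dimensional invariant subspace, since the
contraction on `W N` beats the norm of the inverse (`finiteDimensional_of_surjective`). So `0` is in
the spectrum and is not a Riesz point; the other points of its component are not isolated. -/

theorem smul_resolvent_sub {X : Type*} [NormedAddCommGroup X] [NormedSpace ℂ X]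
    {T : X →L[ℂ] X} {z : ℂ} (hz : z ∈ resolventSet ℂ T) (x : X) :
    z • resolvent T z x - T (resolvent T z x) = x := by
  have h := Ring.mul_inverse_cancel _ (spectrum.mem_resolventSet_iff.1 hz)
  exact congrArg (fun A : X →L[ℂ] X => A x) h

/-- A vector-valued maximum principle: if a function holomorphic on a bounded open set takes values
in a closed convex set on the frontier, then so it does on the closure. -/
theorem mem_of_forall_mem_frontier_mem {B : Type*} [NormedAddCommGroup B] [NormedSpace ℂ B]
    {F : ℂ → B} {Ω : Set ℂ} (hb : Bornology.IsBounded Ω) (hF : DiffContOnCl ℂ F Ω) {K : Set B}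
    (hK : Convex ℝ K) (hKc : IsClosed K) (hfr : ∀ z ∈ frontier Ω, F z ∈ K) {z : ℂ}
    (hz : z ∈ closure Ω) : F z ∈ K := by
  by_contra hnot
  obtain ⟨ℓ, u, hlt, hgt⟩ := RCLike.geometric_hahn_banach_closed_point (𝕜 := ℂ) hK hKc hnot
  -- The modulus of `exp (ℓ ∘ F)` is the exponential of `Re (ℓ ∘ F)`, so the scalar maximum modulus
  -- principle contradicts the separation.
  have hd : DiffContOnCl ℂ (fun w => Complex.exp (ℓ (F w))) Ω :=
    Complex.differentiable_exp.comp_diffContOnCl (ℓ.differentiable.comp_diffContOnCl hF)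
  have h := Complex.norm_le_of_forall_mem_frontier_norm_le hb hd (C := Real.exp u)
    (fun w hw => by
      rw [Complex.norm_exp]
      exact Real.exp_le_exp.2 (hlt _ (hfr w hw)).le) hz
  rw [Complex.norm_exp, Real.exp_le_exp] at h
  exact absurd hgt (not_lt.2 h)

variable {X B : Type*} [NormedAddCommGroup X] [NormedSpace ℂ X] [CompleteSpace X]
  [NormedAddCommGroup B] [NormedSpace ℂ B] [CompleteSpace B]

theorem mem_resolventSet_iff_bijective {T : X →L[ℂ] X} {z : ℂ} :
    z ∈ resolventSet ℂ T ↔ Function.Bijective fun x => z • x - T x := by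
  rw [spectrum.mem_resolventSet_iff, ContinuousLinearMap.isUnit_iff_bijective]
  rfl

theorem differentiableAt_resolvent_apply {T : X →L[ℂ] X} {z : ℂ} (hz : z ∈ resolventSet ℂ T)
    (x : X) : DifferentiableAt ℂ (fun w => resolvent T w x) z :=
  (spectrum.hasDerivAt_resolvent_const_left hz).differentiableAt.clm_apply
    (differentiableAt_const x)

/-- If `j` is an injective intertwiner from `T` to `S`, then a hole of the resolvent set of `T`
on whose closure the resolvent of `S` exists is filled by the resolvent set of `T`. -/
theorem subset_resolventSet_of_intertwining {T : X →L[ℂ] X} {S : B →L[ℂ] B} {j : X →L[ℂ] B}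
    (hj : Function.Injective j) (hTS : ∀ x, j (T x) = S (j x)) {Ω : Set ℂ}
    (hb : Bornology.IsBounded Ω) (hfr : frontier Ω ⊆ resolventSet ℂ T)
    (hcl : closure Ω ⊆ resolventSet ℂ S) : Ω ⊆ resolventSet ℂ T := by
  intro z hz
  have hzS := hcl (subset_closure hz)
  have key : ∀ x, j (z • x - T x) = z • j x - S (j x) := fun x => by simp [hTS]
  rw [mem_resolventSet_iff_bijective]
  have hinjS {w : ℂ} (hw : w ∈ closure Ω) := (mem_resolventSet_iff_bijective.1 (hcl hw)).1
  refine ⟨fun x y hxy => ?_, fun y => ?_⟩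
  · apply hj
    apply hinjS (subset_closure hz)
    simpa only [key] using congrArg j hxy
  · have hFd : DiffContOnCl ℂ (fun w => resolvent S w (j y)) Ω :=
      DifferentiableOn.diffContOnCl fun w hw =>
        (differentiableAt_resolvent_apply (hcl hw) (j y)).differentiableWithinAt
    set K₀ : Set X := (fun w => resolvent T w y) '' frontier Ω with hK₀
    have hK₀c : IsCompact K₀ := (hb.isCompact_closure.of_isClosed_subset isClosed_frontier
      frontier_subset_closure).image_of_continuousOn fun w hw =>
        (differentiableAt_resolvent_apply (hfr hw) y).continuousAt.continuousWithinAt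
    -- Compactness, not just closedness, is needed: it makes the image under `j` closed in `B`. On
    -- the frontier the resolvent of `S` at `j y` is `j` of that of `T` at `y`, hence in this image.
    have hK : IsCompact (closure (convexHull ℝ K₀)) :=
      hK₀c.totallyBounded.convexHull.closure.isCompact_of_isClosed isClosed_closure
    have hconv : Convex ℝ (j '' closure (convexHull ℝ K₀)) :=
      ((convex_convexHull ℝ K₀).closure).linear_image (j.restrictScalars ℝ).toLinearMap
    obtain ⟨g, -, hg⟩ := mem_of_forall_mem_frontier_mem hb hFd hconv
      (hK.image j.continuous).isClosed (fun w hw => by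
        refine ⟨resolvent T w y, subset_closure (subset_convexHull ℝ _ ⟨w, hw, rfl⟩), ?_⟩
        apply hinjS (frontier_subset_closure hw)
        simp only
        rw [smul_resolvent_sub (hcl (frontier_subset_closure hw)), ← hTS, ← map_smul, ← map_sub,
          smul_resolvent_sub (hfr hw)]) (subset_closure hz)
    refine ⟨g, hj ?_⟩
    simp only
    rw [key, hg, smul_resolvent_sub hzS]

end Transfer

/-! ### Polynomial calculus and Riesz decompositions. -/

section RieszDecomposition

open Polynomial

variable {X : Type*} [NormedAddCommGroup X] [NormedSpace ℂ X]

theorem aeval_X_sub_C_mul (T : X →L[ℂ] X) (p : ℂ[X]) (z : ℂ) (x : X) :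
    aeval T ((Polynomial.X - C z) * p) x = T (aeval T p x) - z • aeval T p x := by
  rw [map_mul, map_sub, aeval_X, aeval_C, Algebra.algebraMap_eq_smul_one]
  rfl

/-- Division of `p` by `X - z`, evaluated at `T`. When `p(z) ≠ 0` it recovers `x` from `p(T) x` up
to the range of `T - z`. -/
theorem exists_eval_smul_add_aeval (T : X →L[ℂ] X) (p : ℂ[X]) (z : ℂ) :
    ∃ r : ℂ[X], ∀ x, aeval T p x =
      p.eval z • x + (T (aeval T r x) - z • aeval T r x) := by
  obtain ⟨r, hr⟩ := X_sub_C_dvd_sub_C_eval (a := z) (p := p)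
  refine ⟨r, fun x => ?_⟩
  rw [← aeval_X_sub_C_mul, ← hr, map_sub, aeval_C, Algebra.algebraMap_eq_smul_one]
  exact (add_sub_cancel _ _).symm

theorem aeval_apply_comm (T : X →L[ℂ] X) (p : ℂ[X]) (x : X) :
    aeval T p (T x) = T (aeval T p x) := by
  have h : aeval T (p * Polynomial.X) x = aeval T (Polynomial.X * p) x := by rw [mul_comm]
  simpa using h

theorem aeval_apply_mem (T : X →L[ℂ] X) {W : Submodule ℂ X} (hW : ∀ x ∈ W, T x ∈ W) (p : ℂ[X])
    {x : X} (hx : x ∈ W) : aeval T p x ∈ W := by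
  induction p using Polynomial.induction_on' with
  | add p q hp hq => simpa using W.add_mem hp hq
  | monomial n a =>
    have h : ∀ n : ℕ, (T ^ n) x ∈ W := fun n => by
      induction n with
      | zero => simpa
      | succ n ih => rw [pow_succ']; exact hW _ ih
    simpa [Polynomial.aeval_monomial, Algebra.algebraMap_eq_smul_one] using W.smul_mem a (h n)

/-- An isolated point `μ` of the spectrum is a Riesz point if `μ - T` is bijective on a closed
invariant subspace `W` containing the range of `p(T)`, where `μ` is a simple root of `p`, and
has a finite-dimensional kernel. -/
theorem isRieszPoint_of_invariant [CompleteSpace X] {T : X →L[ℂ] X} {μ : ℂ}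
    (hiso : IsIsolatedPt (spectrum ℂ T) μ) {W : Submodule ℂ X} (hWc : IsClosed (W : Set X))
    (hW : ∀ x ∈ W, T x ∈ W) {q : ℂ[X]} (hq : q.eval μ ≠ 0)
    (hqW : ∀ x, T (aeval T q x) - μ • aeval T q x ∈ W)
    (hinj : ∀ x ∈ W, T x = μ • x → x = 0) (hsurj : ∀ y ∈ W, ∃ x ∈ W, T x - μ • x = y)
    (hfin : FiniteDimensional ℂ (T - algebraMap ℂ (X →L[ℂ] X) μ).ker) :
    IsRieszPoint T μ := by
  obtain ⟨s, hs⟩ := exists_eval_smul_add_aeval T q μ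
  set c := q.eval μ
  set Y₁ : Submodule ℂ X := (T - algebraMap ℂ (X →L[ℂ] X) μ).ker with hY₁
  -- The complement is `q(T)⁻¹ W`: it contains `W` and, by `hqW`, the range of `T - μ`. As `q(μ) ≠
  -- 0`, the plain kernel suffices for `Y₁`.
  set Y₂ : Submodule ℂ X := W.comap (aeval T q).toLinearMap with hY₂
  have mem₁ {x : X} : x ∈ Y₁ ↔ T x = μ • x := by
    simp [hY₁, Algebra.algebraMap_eq_smul_one, sub_eq_zero]
  have mem₂ {x : X} : x ∈ Y₂ ↔ aeval T q x ∈ W := Iff.rfl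
  have hWY : ∀ x ∈ W, x ∈ Y₂ := fun x hx => aeval_apply_mem T hW q hx
  have h₁ : ∀ x ∈ Y₁, T x ∈ Y₁ := fun x hx => by
    rw [mem₁] at hx ⊢
    rw [hx, map_smul, hx]
  have h₂ : ∀ x ∈ Y₂, T x ∈ Y₂ := fun x hx => by
    rw [mem₂, aeval_apply_comm]
    exact hW _ hx
  have hL : ∀ x, T x - μ • x ∈ Y₂ := fun x => by
    rw [mem₂, map_sub, aeval_apply_comm, map_smul]
    exact hqW x
  have hinj₂ : ∀ x ∈ Y₂, T x = μ • x → x = 0 := fun x hx hTx => by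
    have h := hs x
    rw [← aeval_apply_comm T s x, hTx, map_smul, sub_self, add_zero] at h
    refine hinj x ?_ hTx
    rw [mem₂, h] at hx
    exact (W.smul_mem_iff hq).1 hx
  have hsurj₂ : ∀ y ∈ Y₂, ∃ x ∈ Y₂, T x - μ • x = y := fun y hy => by
    obtain ⟨w, hwW, hw⟩ := hsurj (aeval T q y) hy
    -- From `q(T) y = c y + (T - μ) s(T) y` and `(T - μ) w = q(T) y` one gets `(T - μ)(w - s(T) y) =
    -- c y`.
    refine ⟨c⁻¹ • (w - aeval T s y),
      Y₂.smul_mem _ (Y₂.sub_mem (hWY w hwW) (aeval_apply_mem T h₂ s hy)), ?_⟩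
    have h := hs y
    rw [← hw] at h
    have h' : T (w - aeval T s y) - μ • (w - aeval T s y) = c • y := by
      rw [map_sub, smul_sub, sub_sub_sub_comm, h, add_sub_cancel_right]
    rw [map_smul, smul_comm, ← smul_sub, h', inv_smul_smul₀ hq]
  have hcompl : IsCompl Y₁ Y₂ := by
    refine ⟨Submodule.disjoint_def.2 fun x hx₁ hx₂ => hinj₂ x hx₂ (mem₁.1 hx₁), ?_⟩
    rw [codisjoint_iff, eq_top_iff]
    intro x _
    obtain ⟨y, hyY, hy⟩ := hsurj₂ _ (hL x)
    refine Submodule.mem_sup.2 ⟨x - y, ?_, y, hyY, sub_add_cancel x y⟩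
    rw [mem₁, map_sub, smul_sub, ← sub_eq_zero, sub_sub_sub_comm, hy, sub_self]
  have hcl₂ : IsClosed (Y₂ : Set X) := hWc.preimage (aeval T q).continuous
  have : CompleteSpace Y₂ := hcl₂.completeSpace_coe
  have hunit : IsUnit (algebraMap ℂ (Y₂ →L[ℂ] Y₂) μ - T.restrict h₂) := by
    rw [ContinuousLinearMap.isUnit_iff_bijective]
    constructor
    · rw [injective_iff_map_eq_zero]
      intro x hx
      have hx' := congrArg Subtype.val hx
      simp only [sub_apply, Algebra.algebraMap_eq_smul_one,
        smul_apply, one_apply_eq_self, AddSubgroupClass.coe_sub,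
        Submodule.coe_smul, ContinuousLinearMap.coe_restrict_apply, ZeroMemClass.coe_zero] at hx'
      exact Subtype.ext (hinj₂ x x.2 (sub_eq_zero.1 hx').symm)
    · intro y
      obtain ⟨x, hxY, hx⟩ := hsurj₂ _ (Y₂.neg_mem y.2)
      refine ⟨⟨x, hxY⟩, Subtype.ext ?_⟩
      simp only [sub_apply, Algebra.algebraMap_eq_smul_one,
        smul_apply, one_apply_eq_self, AddSubgroupClass.coe_sub,
        Submodule.coe_smul, ContinuousLinearMap.coe_restrict_apply]
      rw [← neg_sub, hx, neg_neg]
  -- Operators on the zero space have empty spectrum, so `{μ}` requires `Y₁ ≠ 0`; this is where `μ`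
  -- being in the spectrum enters.
  have hnt : Nontrivial Y₁ := by
    rw [Submodule.nontrivial_iff_ne_bot]
    intro hbot
    have htop : Y₂ = ⊤ := by simpa [hbot] using hcompl.sup_eq_top
    refine hiso.1 (mem_resolventSet_iff_bijective.2 ⟨fun x y hxy => ?_, fun y => ?_⟩)
    · have hxy' : μ • (x - y) = T (x - y) := by
        rw [map_sub, smul_sub, sub_eq_sub_iff_sub_eq_sub]
        exact hxy
      exact sub_eq_zero.1 (hinj₂ _ (htop ▸ Submodule.mem_top) hxy'.symm)
    · obtain ⟨x, -, hx⟩ := hsurj₂ (-y) (htop ▸ Submodule.mem_top)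
      exact ⟨x, by simp only; rw [← neg_sub, hx, neg_neg]⟩
  refine ⟨hiso, Y₁, Y₂, h₁, h₂, hcompl, ContinuousLinearMap.isClosed_ker _, hcl₂, hfin, ?_, hunit⟩
  have hres : (T.restrict h₁ : Y₁ →L[ℂ] Y₁) = algebraMap ℂ (Y₁ →L[ℂ] Y₁) μ := by
    ext x
    simpa [Algebra.algebraMap_eq_smul_one] using mem₁.1 x.2
  refine (congrArg (spectrum ℂ) hres).trans ?_
  exact spectrum.scalar_eq μ

end RieszDecomposition

/-! ### Spectral theory of an operator with a Koenigs filtration. -/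

section Filtration

variable {X B : Type*} [NormedAddCommGroup X] [NormedSpace ℂ X]
  [NormedAddCommGroup B] [NormedSpace ℂ B]

/-- A decreasing filtration of `X` by closed `T`-invariant subspaces of finite codimension, such
that `T` acts on the `n`-th graded piece as `lam ^ n`, and contracts the `n`-th subspace by the
factor `ρ ^ n` in the norm induced by the intertwiner `j` from `T` to `S`. -/
structure IsKoenigsFiltration (T : X →L[ℂ] X) (S : B →L[ℂ] B) (j : X →L[ℂ] B) (lam : ℂ) (ρ : ℝ)
    (W : ℕ → Submodule ℂ X) : Prop where
  injective : Function.Injective j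
  intertwine : ∀ x, j (T x) = S (j x)
  rho_pos : 0 < ρ
  rho_lt_one : ρ < 1
  pow_injective : Function.Injective fun n : ℕ => lam ^ n
  zero : W 0 = ⊤
  antitone : Antitone W
  isClosed : ∀ n, IsClosed (W n : Set X)
  map_mem : ∀ n, ∀ x ∈ W n, T x ∈ W n
  of_map_mem : ∀ n x, T x ∈ W n → x ∈ W n
  sub_mem : ∀ n, ∀ x ∈ W n, T x - lam ^ n • x ∈ W (n + 1)
  exists_ker_le : ∀ n, ∃ f : X →ₗ[ℂ] (Fin n → ℂ), f.ker ≤ W n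
  norm_le : ∀ n, ∀ x ∈ W n, ‖j (T x)‖ ≤ ρ ^ n * ‖j x‖

namespace IsKoenigsFiltration

variable {T : X →L[ℂ] X} {S : B →L[ℂ] B} {j : X →L[ℂ] B} {lam : ℂ} {ρ : ℝ} {W : ℕ → Submodule ℂ X}

theorem finiteDimensional_of_disjoint (h : IsKoenigsFiltration T S j lam ρ W) {n : ℕ}
    {Y : Submodule ℂ X} (hY : ∀ x ∈ Y, x ∈ W n → x = 0) : FiniteDimensional ℂ Y := by
  obtain ⟨f, hf⟩ := h.exists_ker_le n
  refine FiniteDimensional.of_injective (f.domRestrict Y) ?_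
  rw [injective_iff_map_eq_zero]
  intro x hx
  exact Subtype.ext (hY x x.2 (hf hx))

/-- An invariant subspace on which `T` is invertible is finite-dimensional. -/
theorem finiteDimensional_of_surjective (h : IsKoenigsFiltration T S j lam ρ W)
    {Y : Submodule ℂ X} {M : ℝ} (hY : ∀ y ∈ Y, ∃ x ∈ Y, T x = y ∧ ‖x‖ ≤ M * ‖y‖) :
    FiniteDimensional ℂ Y := by
  wlog hM : 0 < M generalizing M
  · refine this (M := 1) (fun y hy => ?_) one_pos
    obtain ⟨x, hx, hTx, hn⟩ := hY y hy
    exact ⟨x, hx, hTx, hn.trans (mul_le_mul_of_nonneg_right (by linarith) (norm_nonneg y))⟩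
  obtain ⟨N, hN⟩ := exists_pow_lt_of_lt_one (inv_pos.2 hM) h.rho_lt_one
  have hρ : 0 < ρ ^ N := pow_pos h.rho_pos N
  have hlt : ρ ^ N * M < 1 := by rwa [← lt_div_iff₀ hM, one_div]
  refine h.finiteDimensional_of_disjoint (n := N) fun x hxY hxW => ?_
  -- Taking `k` successive preimages costs `M ^ k` in the norm of `X` but gains `(ρ ^ N) ^ k` in the
  -- norm through `j`; `of_map_mem` keeps them in `W N`.
  have key : ∀ k : ℕ, ∃ y ∈ Y, y ∈ W N ∧ ‖y‖ ≤ M ^ k * ‖x‖ ∧ ‖j x‖ ≤ (ρ ^ N) ^ k * ‖j y‖ := by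
    intro k
    induction k with
    | zero => exact ⟨x, hxY, hxW, by simp, by simp⟩
    | succ k ih =>
      obtain ⟨y, hyY, hyW, h₁, h₂⟩ := ih
      obtain ⟨z, hzY, rfl, hz⟩ := hY y hyY
      have hzW := h.of_map_mem N z hyW
      refine ⟨z, hzY, hzW, ?_, ?_⟩
      · calc ‖z‖ ≤ M * ‖T z‖ := hz
          _ ≤ M * (M ^ k * ‖x‖) := by gcongr
          _ = M ^ (k + 1) * ‖x‖ := by ring
      · calc ‖j x‖ ≤ (ρ ^ N) ^ k * ‖j (T z)‖ := h₂
          _ ≤ (ρ ^ N) ^ k * (ρ ^ N * ‖j z‖) := by gcongr; exact h.norm_le N z hzW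
          _ = (ρ ^ N) ^ (k + 1) * ‖j z‖ := by ring
  have hle : ∀ k : ℕ, ‖j x‖ ≤ (ρ ^ N * M) ^ k * (‖j‖ * ‖x‖) := fun k => by
    obtain ⟨y, -, -, h₁, h₂⟩ := key k
    calc ‖j x‖ ≤ (ρ ^ N) ^ k * ‖j y‖ := h₂
      _ ≤ (ρ ^ N) ^ k * (‖j‖ * (M ^ k * ‖x‖)) := by
        gcongr
        exact (j.le_opNorm y).trans (by gcongr)
      _ = (ρ ^ N * M) ^ k * (‖j‖ * ‖x‖) := by rw [mul_pow]; ring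
  have hlim := (tendsto_pow_atTop_nhds_zero_of_lt_one (by positivity) hlt).mul_const (‖j‖ * ‖x‖)
  rw [zero_mul] at hlim
  have h0 : ‖j x‖ ≤ 0 := ge_of_tendsto' hlim hle
  exact h.injective ((norm_le_zero_iff.1 h0).trans (map_zero j).symm)

/-- On `W n / W (n + 1)` the operator `z - T` is the scalar `z - lam ^ n`, nonzero for `n < N`, so
membership climbs one level at a time. -/
theorem mem_of_smul_sub_mem (h : IsKoenigsFiltration T S j lam ρ W) {N : ℕ} {z : ℂ}
    (hz : ∀ m < N, z ≠ lam ^ m) {x : X} (hx : z • x - T x ∈ W N) : x ∈ W N := by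
  have key : ∀ n ≤ N, x ∈ W n := by
    intro n
    induction n with
    | zero => intro _; rw [h.zero]; exact Submodule.mem_top
    | succ n ih =>
      intro hn
      have h₁ := (W (n + 1)).add_mem (h.antitone hn hx) (h.sub_mem n x (ih (by omega)))
      rw [sub_add_sub_cancel, ← sub_smul] at h₁
      exact ((W (n + 1)).smul_mem_iff (sub_ne_zero.2 (hz n hn))).1 h₁
  exact key N le_rfl

open Polynomial in
theorem aeval_prod_mem (h : IsKoenigsFiltration T S j lam ρ W) (N : ℕ) (x : X) :
    aeval T (∏ m ∈ Finset.range N, (Polynomial.X - C (lam ^ m))) x ∈ W N := by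
  induction N with
  | zero => rw [h.zero]; exact Submodule.mem_top
  | succ N ih =>
    have h₁ := h.sub_mem N _ ih
    rw [Finset.prod_range_succ, mul_comm, aeval_X_sub_C_mul]
    exact h₁

variable [CompleteSpace X]

-- Replaces the block-triangular argument on `W N` and `X / W N`: `q(T)` maps `X` into `W N`, where
-- `z - T` can be inverted, and `q(T) = q(z) + (T - z) r(T)` carries the solution back to `X`.
open Polynomial in
theorem mem_resolventSet_of_bijOn (h : IsKoenigsFiltration T S j lam ρ W) {N : ℕ} {z : ℂ}
    (hz : ∀ m < N, z ≠ lam ^ m) (hbij : BijOn (fun x => z • x - T x) (W N) (W N)) :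
    z ∈ resolventSet ℂ T := by
  rw [mem_resolventSet_iff_bijective]
  constructor
  · intro x y hxy
    have h0 : z • (x - y) - T (x - y) = 0 := by
      rw [map_sub, smul_sub, sub_sub_sub_comm]
      exact sub_eq_zero.2 hxy
    have hm : x - y ∈ W N := h.mem_of_smul_sub_mem hz (h0 ▸ (W N).zero_mem)
    exact sub_eq_zero.1 (hbij.injOn hm (W N).zero_mem (by simpa using h0))
  · intro y
    set q : ℂ[X] := ∏ m ∈ Finset.range N, (Polynomial.X - C (lam ^ m)) with hq
    have hq0 : q.eval z ≠ 0 := by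
      rw [hq, eval_prod, Finset.prod_ne_zero_iff]
      intro m hm
      simpa [sub_eq_zero] using hz m (Finset.mem_range.1 hm)
    obtain ⟨r, hr⟩ := exists_eval_smul_add_aeval T q z
    obtain ⟨w, -, hw⟩ := hbij.surjOn (h.aeval_prod_mem N y)
    refine ⟨(q.eval z)⁻¹ • (w + aeval T r y), ?_⟩
    have h₁ := hr y
    have h₂ : z • (w + aeval T r y) - T (w + aeval T r y) = q.eval z • y := by
      have hw' : z • w - T w = aeval T q y := hw
      rw [smul_add, map_add, add_sub_add_comm, hw', h₁]
      abel
    simp only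
    rw [map_smul, smul_comm, ← smul_sub, h₂, inv_smul_smul₀ hq0]

-- The powers of `lam` are distinct, so `lam ^ n` is a simple root of the product that maps `X` into
-- `W N`; `q` is that product without its factor at `n`.
open Polynomial in
theorem isRieszPoint_of_bijOn (h : IsKoenigsFiltration T S j lam ρ W) {N n : ℕ} (hn : n < N)
    (hiso : IsIsolatedPt (spectrum ℂ T) (lam ^ n))
    (hbij : BijOn (fun x => lam ^ n • x - T x) (W N) (W N)) : IsRieszPoint T (lam ^ n) := by
  have hinj : ∀ x ∈ W N, T x = lam ^ n • x → x = 0 := fun x hx hTx =>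
    hbij.injOn hx (W N).zero_mem (by simp [hTx])
  refine isRieszPoint_of_invariant hiso (h.isClosed N) (h.map_mem N)
    (q := ∏ m ∈ (Finset.range N).erase n, (Polynomial.X - C (lam ^ m))) ?_ ?_ hinj ?_ ?_
  · rw [eval_prod, Finset.prod_ne_zero_iff]
    intro m hm
    have hne : lam ^ n ≠ lam ^ m := fun e => (Finset.ne_of_mem_erase hm) (h.pow_injective e).symm
    simpa [sub_eq_zero] using hne
  · intro x
    have h₁ := h.aeval_prod_mem N x
    rw [← Finset.mul_prod_erase _ _ (Finset.mem_range.2 hn), aeval_X_sub_C_mul] at h₁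
    exact h₁
  · intro y hy
    obtain ⟨x, hx, hxy⟩ := hbij.surjOn ((W N).neg_mem hy)
    exact ⟨x, hx, by rw [← neg_sub]; exact neg_eq_iff_eq_neg.2 hxy⟩
  · refine h.finiteDimensional_of_disjoint (n := N) fun x hx hxW => hinj x hxW ?_
    simpa [Algebra.algebraMap_eq_smul_one, sub_eq_zero] using hx

variable [CompleteSpace B]

/-- The resolvent of `T` on the `N`-th subspace of the filtration fills the holes of the
resolvent set away from `0`. -/
theorem bijOn_of_mem (h : IsKoenigsFiltration T S j lam ρ W) {N : ℕ} {Ω : Set ℂ}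
    (hb : Bornology.IsBounded Ω)
    (hfr : ∀ z ∈ frontier Ω, z ∈ resolventSet ℂ T ∧ ∀ m < N, z ≠ lam ^ m)
    (hcl : ∀ z ∈ closure Ω, ρ ^ N < ‖z‖) {z : ℂ} (hz : z ∈ Ω) :
    BijOn (fun x => z • x - T x) (W N) (W N) := by
  have : CompleteSpace (W N) := (h.isClosed N).completeSpace_coe
  -- The bound `ρ ^ N` for `S` is known only on the image of `W N`, hence on its closure, so `S` is
  -- restricted there.
  set D : Submodule ℂ B := ((W N).map j.toLinearMap).topologicalClosure with hD
  have : CompleteSpace D := (Submodule.isClosed_topologicalClosure _).completeSpace_coe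
  have hjD : ∀ x ∈ W N, j x ∈ D := fun x hx =>
    Submodule.le_topologicalClosure _ (Submodule.mem_map_of_mem hx)
  have hSD : ∀ f ∈ D, S f ∈ D := by
    intro f hf
    refine map_mem_closure S.continuous hf ?_
    rintro _ ⟨x, hx, rfl⟩
    exact ⟨T x, h.map_mem N x hx, h.intertwine x⟩
  have hSn : ∀ f ∈ D, ‖S f‖ ≤ ρ ^ N * ‖f‖ := by
    intro f hf
    refine closure_minimal (t := {f | ‖S f‖ ≤ ρ ^ N * ‖f‖}) ?_
      (isClosed_le (by fun_prop) (by fun_prop)) hf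
    rintro _ ⟨x, hx, rfl⟩
    have := h.norm_le N x hx
    rwa [h.intertwine] at this
  set T' : W N →L[ℂ] W N := T.restrict (h.map_mem N) with hT'
  set S' : D →L[ℂ] D := S.restrict hSD with hS'
  have hS'n : ‖S'‖ ≤ ρ ^ N :=
    S'.opNorm_le_bound (pow_nonneg h.rho_pos.le N) fun f => hSn f f.2
  have hsub : Ω ⊆ resolventSet ℂ T' := by
    refine subset_resolventSet_of_intertwining (S := S') (j := j.restrict hjD) ?_ ?_ hb ?_ ?_
    · intro x y hxy
      exact Subtype.ext (h.injective (congrArg Subtype.val hxy))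
    · intro x
      exact Subtype.ext (h.intertwine x)
    · intro w hw
      obtain ⟨hwT, hwm⟩ := hfr w hw
      rw [mem_resolventSet_iff_bijective] at hwT ⊢
      constructor
      · intro x y hxy
        exact Subtype.ext (hwT.1 (congrArg Subtype.val hxy))
      · intro y
        obtain ⟨x, hx⟩ := hwT.2 y
        exact ⟨⟨x, h.mem_of_smul_sub_mem hwm (by simp only at hx; rw [hx]; exact y.2)⟩,
          Subtype.ext hx⟩
    · intro w hw
      refine spectrum.mem_resolventSet_of_norm_lt_mul (lt_of_le_of_lt ?_ (hcl w hw))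
      exact (mul_le_of_le_one_right (norm_nonneg _) ContinuousLinearMap.norm_id_le).trans hS'n
  obtain ⟨hinj, hsurj⟩ := mem_resolventSet_iff_bijective.1 (hsub hz)
  refine ⟨fun x hx => (W N).sub_mem ((W N).smul_mem z hx) (h.map_mem N x hx), ?_, ?_⟩
  · intro x hx y hy hxy
    exact congrArg Subtype.val (@hinj ⟨x, hx⟩ ⟨y, hy⟩ (Subtype.ext hxy))
  · intro y hy
    obtain ⟨x, hx⟩ := hsurj ⟨y, hy⟩
    exact ⟨x, x.2, congrArg Subtype.val hx⟩

/-- A neighbourhood of `U` is a hole of the type `bijOn_of_mem` fills, which leaves only the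
eigenvalues of `T` on `X / W N` as possible points of `U`. -/
theorem exists_eq_pow_and_isRieszPoint (h : IsKoenigsFiltration T S j lam ρ W) {U V : Set ℂ}
    (hU : IsClosed U) (hV : IsClosed V) (hUV : Disjoint U V) (hσ : spectrum ℂ T = U ∪ V)
    (h0 : (0 : ℂ) ∉ U) {μ : ℂ} (hμ : μ ∈ U) : ∃ n : ℕ, μ = lam ^ n ∧ IsRieszPoint T μ := by
  obtain ⟨ε, hε, hball⟩ := Metric.isOpen_iff.1 hU.isOpen_compl 0 h0
  obtain ⟨N, hN⟩ := exists_pow_lt_of_lt_one hε h.rho_lt_one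
  set F : Set ℂ := (fun m : ℕ => lam ^ m) '' (Finset.range N : Set ℕ) with hF
  have hFf : F.Finite := (Finset.finite_toSet _).image _
  -- To be avoided by `Ω`: the rest of the spectrum, the disc where the bound on `S` gives no
  -- resolvent, and the `lam ^ m` outside `U`, so that the frontier of `Ω` meets no `lam ^ m` with
  -- `m < N`.
  set V' : Set ℂ := V ∪ Metric.closedBall 0 (ρ ^ N) ∪ (F \ U) with hV'
  have hV'c : IsClosed V' := (hV.union Metric.isClosed_closedBall).union hFf.sdiff.isClosed
  have hUV' : U ⊆ V'ᶜ := by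
    rintro z hz ((hzV | hzb) | hzF)
    · exact disjoint_left.1 hUV hz hzV
    · exact hball (Metric.closedBall_subset_ball hN hzb) hz
    · exact hzF.2 hz
  have hUc : IsCompact U := (spectrum.isCompact T).of_isClosed_subset hU (hσ ▸ subset_union_left)
  obtain ⟨Ω, hΩo, hUΩ, hΩV, hΩc⟩ :=
    exists_open_between_and_isCompact_closure hUc hV'c.isOpen_compl hUV'
  have hbij : ∀ z ∈ Ω, BijOn (fun x => z • x - T x) (W N) (W N) := by
    intro z hz
    refine h.bijOn_of_mem (hΩc.isBounded.subset subset_closure) ?_ ?_ hz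
    · intro w hw
      rw [hΩo.frontier_eq] at hw
      have hwU : w ∉ U := fun hwU => hw.2 (hUΩ hwU)
      have hwV : w ∉ V' := hΩV hw.1
      refine ⟨by_contra fun hwσ : w ∈ spectrum ℂ T => ?_, ?_⟩
      · rcases hσ ▸ hwσ with hw' | hw'
        · exact hwU hw'
        · exact hwV (Or.inl (Or.inl hw'))
      · rintro m hm rfl
        exact hwV (Or.inr ⟨⟨m, by simpa using hm, rfl⟩, hwU⟩)
    · intro w hw
      by_contra hle
      exact hΩV hw (Or.inl (Or.inr (mem_closedBall_zero_iff.2 (not_lt.1 hle))))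
  have hpow : ∀ z ∈ U, ∃ n < N, z = lam ^ n := by
    intro z hz
    by_contra! hne
    have hzσ : z ∈ spectrum ℂ T := hσ ▸ Or.inl hz
    exact hzσ (h.mem_resolventSet_of_bijOn hne (hbij z (hUΩ hz)))
  obtain ⟨n, hn, rfl⟩ := hpow μ hμ
  refine ⟨n, rfl, h.isRieszPoint_of_bijOn hn ⟨hσ ▸ Or.inl hμ, ?_⟩ (hbij _ (hUΩ hμ))⟩
  have hUf : U.Finite := hFf.subset fun z hz => by
    obtain ⟨m, hm, rfl⟩ := hpow z hz
    exact ⟨m, by simpa using hm, rfl⟩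
  have hC : IsClosed (V ∪ (U \ {lam ^ n})) := hV.union hUf.sdiff.isClosed
  refine ⟨_, hC.isOpen_compl.mem_nhds ?_, ?_⟩
  · rintro (hv | hu)
    · exact disjoint_left.1 hUV hμ hv
    · exact hu.2 rfl
  · rintro z ⟨hz, hzσ⟩
    by_contra hne
    rcases hσ ▸ hzσ with hzU | hzV
    · exact hz (Or.inr ⟨hzU, hne⟩)
    · exact hz (Or.inl hzV)

/-- The spectrum of an operator with a Koenigs filtration on an infinite-dimensional space. -/
theorem spectrum_eq (h : IsKoenigsFiltration T S j lam ρ W) (hdim : ¬ FiniteDimensional ℂ X) :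
    (0 : ℂ) ∈ spectrum ℂ T ∧
    spectrum ℂ T = connectedComponentIn (spectrum ℂ T) 0 ∪
      {μ : ℂ | ∃ n : ℕ, μ = lam ^ n ∧ IsIsolatedPt (spectrum ℂ T) (lam ^ n)} ∧
    essSpectrum T = connectedComponentIn (spectrum ℂ T) 0 := by
  have h0 : (0 : ℂ) ∈ spectrum ℂ T := by
    intro h0
    have hsol := smul_resolvent_sub h0
    simp only [zero_smul, zero_sub] at hsol
    have hfin := h.finiteDimensional_of_surjective (Y := ⊤) (M := ‖resolvent T (0 : ℂ)‖) fun y _ =>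
      ⟨-resolvent T (0 : ℂ) y, Submodule.mem_top, by rw [map_neg, hsol],
        by rw [norm_neg]; exact (resolvent T (0 : ℂ)).le_opNorm y⟩
    exact hdim (LinearEquiv.finiteDimensional (Submodule.topEquiv : _ ≃ₗ[ℂ] X))
  have hout : ∀ μ ∈ spectrum ℂ T, μ ∉ connectedComponentIn (spectrum ℂ T) 0 →
      ∃ n : ℕ, μ = lam ^ n ∧ IsRieszPoint T μ := by
    intro μ hμ hμc
    have : CompactSpace (spectrum ℂ T) := isCompact_iff_compactSpace.1 (spectrum.isCompact T)
    -- In a compact Hausdorff space components are intersections of clopen sets, so a clopen set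
    -- separates `μ` from `0`.
    rw [connectedComponentIn_eq_image h0, connectedComponent_eq_iInter_isClopen] at hμc
    obtain ⟨Z, hZ, h0Z, hμZ⟩ : ∃ Z : Set (spectrum ℂ T), IsClopen Z ∧ ⟨0, h0⟩ ∈ Z ∧
        ⟨μ, hμ⟩ ∉ Z := by
      by_contra! hall
      exact hμc ⟨⟨μ, hμ⟩, mem_iInter.2 fun Z => hall Z.1 Z.2.1 Z.2.2, rfl⟩
    have hemb := (spectrum.isClosed (𝕜 := ℂ) T).isClosedEmbedding_subtypeVal
    refine h.exists_eq_pow_and_isRieszPoint (U := (↑) '' Zᶜ) (V := (↑) '' Z)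
      (hemb.isClosedMap _ hZ.compl.isClosed) (hemb.isClosedMap _ hZ.isClosed)
      ((disjoint_image_iff Subtype.val_injective).2 disjoint_compl_left) ?_ ?_
      ⟨⟨μ, hμ⟩, hμZ, rfl⟩
    · rw [← image_union, compl_union_self, image_univ, Subtype.range_coe]
    · rintro ⟨x, hx, hx0⟩
      exact hx ((Subtype.ext hx0 : x = ⟨0, h0⟩) ▸ h0Z)
  refine ⟨h0, ?_, ?_⟩
  · apply Subset.antisymm
    · intro μ hμ
      by_cases hμc : μ ∈ connectedComponentIn (spectrum ℂ T) 0
      · exact Or.inl hμc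
      · obtain ⟨n, rfl, hR⟩ := hout μ hμ hμc
        exact Or.inr ⟨n, rfl, hR.1⟩
    · rintro μ (hμ | ⟨n, rfl, hn⟩)
      · exact connectedComponentIn_subset _ _ hμ
      · exact hn.1
  · apply Subset.antisymm
    · rintro μ ⟨hμ, hR⟩
      by_contra hμc
      obtain ⟨n, -, hR'⟩ := hout μ hμ hμc
      exact hR hR'
    · intro μ hμ
      refine ⟨connectedComponentIn_subset _ _ hμ, fun hR => ?_⟩
      obtain ⟨O, hO, hOs⟩ := hR.1.2
      -- A nonzero isolated point would disconnect the component, which also contains `0`.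
      have hμ0 : μ = 0 := by
        by_contra hne
        obtain ⟨O', hO'O, hO'o, hμO'⟩ := mem_nhds_iff.1 hO
        obtain ⟨z, hzc, hz1, hz2⟩ := isPreconnected_connectedComponentIn (F := spectrum ℂ T)
          (x := 0) O' {μ}ᶜ hO'o isOpen_compl_singleton (fun z _ => by
            by_cases hz : z = μ
            · exact Or.inl (hz ▸ hμO')
            · exact Or.inr hz) ⟨μ, hμ, hμO'⟩ ⟨0, mem_connectedComponentIn h0, Ne.symm hne⟩
        exact hz2 (hOs ⟨hO'O hz1, connectedComponentIn_subset _ _ hzc⟩)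
      subst hμ0
      obtain ⟨-, Y₁, Y₂, h₁, h₂, hcompl, -, -, hfin₁, -, hunit⟩ := hR
      have hmem : (0 : ℂ) ∈ resolventSet ℂ (T.restrict h₂ : Y₂ →L[ℂ] Y₂) := hunit
      have hsol := smul_resolvent_sub hmem
      simp only [zero_smul, zero_sub] at hsol
      have hfin₂ : FiniteDimensional ℂ Y₂ := by
        refine h.finiteDimensional_of_surjective
          (M := ‖resolvent (T.restrict h₂ : Y₂ →L[ℂ] Y₂) (0 : ℂ)‖) fun y hy => ?_
        refine ⟨_, (-resolvent (T.restrict h₂ : Y₂ →L[ℂ] Y₂) (0 : ℂ) ⟨y, hy⟩).2, ?_, ?_⟩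
        · have := congrArg Subtype.val (hsol ⟨y, hy⟩)
          rw [← map_neg] at this
          exact (ContinuousLinearMap.coe_restrict_apply h₂ _).symm.trans this
        · have := (resolvent (T.restrict h₂ : Y₂ →L[ℂ] Y₂) (0 : ℂ)).le_opNorm ⟨y, hy⟩
          rw [← norm_neg] at this
          exact this
      exact hdim (LinearEquiv.finiteDimensional (Submodule.prodEquivOfIsCompl Y₁ Y₂ hcompl))

end IsKoenigsFiltration

end Filtration

/-! ### The Schwarz lemma at the fixed point. -/

section SchwarzPick

open ComplexConjugate

/-- The holomorphic involution of the disc exchanging `0` and `a`. -/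
noncomputable def discInvolution (a z : ℂ) : ℂ := (a - z) / (1 - conj a * z)

variable {a : ℂ}

theorem one_sub_conj_mul_ne_zero (ha : a ∈ Disc) {z : ℂ} (hz : z ∈ Disc) : 1 - conj a * z ≠ 0 := by
  rw [mem_ball_zero_iff] at ha hz
  intro h
  have h₁ : ‖conj a * z‖ = 1 := by rw [← sub_eq_zero.1 h, norm_one]
  rw [norm_mul, RCLike.norm_conj] at h₁
  nlinarith [norm_nonneg a, norm_nonneg z]

theorem mapsTo_discInvolution (ha : a ∈ Disc) : MapsTo (discInvolution a) Disc Disc := by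
  intro z hz
  have hne := one_sub_conj_mul_ne_zero ha hz
  rw [mem_ball_zero_iff] at *
  rw [discInvolution, norm_div, div_lt_one (norm_pos_iff.2 hne)]
  refine lt_of_pow_lt_pow_left₀ 2 (norm_nonneg _) ?_
  have h : ‖1 - conj a * z‖ ^ 2 - ‖a - z‖ ^ 2 = (1 - ‖a‖ ^ 2) * (1 - ‖z‖ ^ 2) := by
    simp only [Complex.sq_norm, Complex.normSq_apply, Complex.sub_re, Complex.sub_im,
      Complex.mul_re, Complex.mul_im, Complex.conj_re, Complex.conj_im, Complex.one_re,
      Complex.one_im]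
    ring
  have h₁ : 0 < 1 - ‖a‖ ^ 2 := by nlinarith [norm_nonneg a]
  have h₂ : 0 < 1 - ‖z‖ ^ 2 := by nlinarith [norm_nonneg z]
  nlinarith [mul_pos h₁ h₂]

theorem discInvolution_involutive (ha : a ∈ Disc) {z : ℂ} (hz : z ∈ Disc) :
    discInvolution a (discInvolution a z) = z := by
  have hne := one_sub_conj_mul_ne_zero ha hz
  have hne' := one_sub_conj_mul_ne_zero ha (mapsTo_discInvolution ha hz)
  have hw : discInvolution a z * (1 - conj a * z) = a - z := div_mul_cancel₀ _ hne
  rw [discInvolution, div_eq_iff hne']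
  linear_combination -hw

theorem differentiableOn_discInvolution (ha : a ∈ Disc) :
    DifferentiableOn ℂ (discInvolution a) Disc := by
  unfold discInvolution
  exact DifferentiableOn.div (by fun_prop) (by fun_prop) fun z hz => one_sub_conj_mul_ne_zero ha hz

theorem isHolSelfMap_discInvolution (ha : a ∈ Disc) : IsHolSelfMap (discInvolution a) :=
  ⟨differentiableOn_discInvolution ha, mapsTo_discInvolution ha⟩

theorem discInvolution_zero : discInvolution a 0 = a := by simp [discInvolution]

theorem discInvolution_self : discInvolution a a = 0 := by simp [discInvolution]

theorem IsHolSelfMap.comp {f g : ℂ → ℂ} (hf : IsHolSelfMap f) (hg : IsHolSelfMap g) :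
    IsHolSelfMap (f ∘ g) :=
  ⟨hf.differentiableOn.comp hg.differentiableOn hg.mapsTo, hf.mapsTo.comp hg.mapsTo⟩

theorem IsHolSelfMap.differentiableAt {f : ℂ → ℂ} (hf : IsHolSelfMap f) {z : ℂ} (hz : z ∈ Disc) :
    DifferentiableAt ℂ f z :=
  hf.differentiableOn.differentiableAt (Metric.isOpen_ball.mem_nhds hz)

theorem isHolSelfMap_const_mul {c : ℂ} (hc : ‖c‖ = 1) : IsHolSelfMap (c * ·) :=
  ⟨by fun_prop, fun z hz => by
    rw [mem_ball_zero_iff] at *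
    rwa [norm_mul, hc, one_mul]⟩

/-- A Schröder map is strictly contracting to first order at its fixed point. -/
theorem IsSchroderMap.norm_deriv_lt_one {φ : ℂ → ℂ} {α : ℂ} (hφ : IsSchroderMap φ α) :
    ‖deriv φ α‖ < 1 := by
  have hα := hφ.mem_disc
  have h0 : (0 : ℂ) ∈ Disc := Metric.mem_ball_self one_pos
  have hτ := isHolSelfMap_discInvolution hα
  have hinv := fun {z : ℂ} (hz : z ∈ Disc) => discInvolution_involutive hα hz
  set τ := discInvolution α with hτdef
  -- Conjugation moves the fixed point to `0` without changing the derivative there; equality in the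
  -- Schwarz lemma would make `Φ` a rotation and `φ` an automorphism.
  set Φ := τ ∘ φ ∘ τ with hΦ
  have hΦs : IsHolSelfMap Φ := hτ.comp (hφ.toIsHolSelfMap.comp hτ)
  have hτ0 : τ 0 = α := discInvolution_zero
  have hτα : τ α = 0 := discInvolution_self
  have hΦ0 : Φ 0 = 0 := by simp only [hΦ, Function.comp_apply, hτ0, hφ.fixed, hτα]
  have hττ : deriv τ α * deriv τ 0 = 1 := by
    have h₁ : HasDerivAt (τ ∘ τ) (deriv τ α * deriv τ 0) 0 :=
      HasDerivAt.comp (0 : ℂ) (by rw [hτ0]; exact (hτ.differentiableAt hα).hasDerivAt)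
        (hτ.differentiableAt h0).hasDerivAt
    refine h₁.unique ((hasDerivAt_id (0 : ℂ)).congr_of_eventuallyEq ?_)
    filter_upwards [Metric.isOpen_ball.mem_nhds h0] with z hz
    exact hinv hz
  have hΦd : deriv Φ 0 = deriv φ α := by
    have h₁ : HasDerivAt (φ ∘ τ) (deriv φ α * deriv τ 0) 0 :=
      HasDerivAt.comp (0 : ℂ)
        (by rw [hτ0]; exact (hφ.toIsHolSelfMap.differentiableAt hα).hasDerivAt)
        (hτ.differentiableAt h0).hasDerivAt
    have h₂ : HasDerivAt Φ (deriv τ α * (deriv φ α * deriv τ 0)) 0 :=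
      HasDerivAt.comp (0 : ℂ) (by
        rw [Function.comp_apply, hτ0, hφ.fixed]
        exact (hτ.differentiableAt hα).hasDerivAt) h₁
    rw [h₂.deriv, mul_left_comm, hττ, mul_one]
  have hmaps : MapsTo Φ (Metric.ball 0 1) (Metric.closedBall (Φ 0) 1) := by
    rw [hΦ0]
    exact hΦs.mapsTo.mono_right Metric.ball_subset_closedBall
  have hle := Complex.norm_deriv_le_one_of_mapsTo_ball hΦs.differentiableOn hmaps one_pos
  rw [← hΦd]
  refine hle.lt_of_ne fun heq => hφ.not_aut ?_
  obtain ⟨c, hc, hΦc⟩ := Complex.affine_of_mapsTo_ball_of_exists_norm_dslope_eq_div'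
    hΦs.differentiableOn hmaps ⟨0, h0, by rw [dslope_same, heq, div_one]⟩
  rw [div_one] at hc
  have hc0 : c ≠ 0 := norm_ne_zero_iff.1 (by rw [hc]; exact one_ne_zero)
  have hφc : ∀ z ∈ Disc, φ z = τ (c * τ z) := fun z hz => by
    have h₁ := hΦc (hτ.mapsTo hz)
    simp only [hΦ0, sub_zero, zero_add, smul_eq_mul] at h₁
    rw [mul_comm c, ← h₁]
    simp only [hΦ, Function.comp_apply]
    rw [hinv hz, hinv (hφ.mapsTo hz)]
  have hψ : IsHolSelfMap (τ ∘ (c⁻¹ * ·) ∘ τ) :=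
    hτ.comp ((isHolSelfMap_const_mul (by rw [norm_inv, hc, inv_one])).comp hτ)
  refine ⟨hφ.toIsHolSelfMap, _, hψ, fun z hz => ?_, fun z hz => ?_⟩
  · simp only [Function.comp_apply]
    rw [hφc z hz, hinv ((isHolSelfMap_const_mul hc).mapsTo (hτ.mapsTo hz)),
      inv_mul_cancel_left₀ hc0, hinv hz]
  · rw [hφc _ (hψ.mapsTo hz)]
    simp only [Function.comp_apply]
    rw [hinv
      ((isHolSelfMap_const_mul (by rw [norm_inv, hc, inv_one])).mapsTo (hτ.mapsTo hz)),
      mul_inv_cancel_left₀ hc0, hinv hz]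

theorem IsSchroderMap.pow_deriv_injective {φ : ℂ → ℂ} {α : ℂ} (hφ : IsSchroderMap φ α) :
    Function.Injective fun n : ℕ => deriv φ α ^ n := by
  intro m n hmn
  have h := congrArg norm hmn
  simp only [norm_pow] at h
  exact (pow_right_strictAnti₀ (norm_pos_iff.2 hφ.deriv_ne_zero) hφ.norm_deriv_lt_one).injective h

/-- The difference quotient at `α` extends continuously with value `φ'(α)`, so its modulus stays
below any fixed `ρ > |φ'(α)|` near `α`. -/
theorem IsSchroderMap.exists_contracting_closedBall {φ : ℂ → ℂ} {α : ℂ} (hφ : IsSchroderMap φ α) :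
    ∃ ρ r : ℝ, 0 < ρ ∧ ρ < 1 ∧ 0 < r ∧ Metric.closedBall α r ⊆ Disc ∧
      ∀ z ∈ Metric.closedBall α r, ‖φ z - α‖ ≤ ρ * ‖z - α‖ := by
  obtain ⟨ρ, hρ, hρ1⟩ := exists_between hφ.norm_deriv_lt_one
  have hcont : ContinuousAt (dslope φ α) α :=
    continuousAt_dslope_same.2 (hφ.toIsHolSelfMap.differentiableAt hφ.mem_disc)
  have hev : ∀ᶠ z in 𝓝 α, z ∈ Disc ∧ ‖dslope φ α z‖ < ρ :=
    Filter.Eventually.and (Metric.isOpen_ball.mem_nhds hφ.mem_disc)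
      (hcont.norm.eventually_lt_const (by simpa only [dslope_same] using hρ))
  obtain ⟨r, hr, hball⟩ := Metric.nhds_basis_closedBall.eventually_iff.1 hev
  refine ⟨ρ, r, (norm_nonneg _).trans_lt hρ, hρ1, hr, fun z hz => (hball hz).1, fun z hz => ?_⟩
  have h := sub_smul_dslope φ α z
  rw [hφ.fixed] at h
  rw [← h, norm_smul, mul_comm]
  exact mul_le_mul_of_nonneg_right (hball hz).2.le (norm_nonneg _)

end SchwarzPick

/-! ### Order of vanishing at the fixed point. -/

section VanishingOrder

/-- The extension by zero of a holomorphic function on the disc. -/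
noncomputable def holExt : Hol →ₗ[ℂ] (ℂ → ℂ) where
  toFun f := Function.extend Subtype.val (f : C(Disc, ℂ)) 0
  map_add' f g := by
    have h := Function.extend_add (Subtype.val : Disc → ℂ) (f : C(Disc, ℂ)) (g : C(Disc, ℂ)) 0 0
    rw [add_zero] at h
    exact h
  map_smul' c f := by
    have h := Function.extend_smul c (Subtype.val : Disc → ℂ) (f : C(Disc, ℂ)) 0
    rw [smul_zero] at h
    exact h

theorem holExt_apply (f : Hol) {z : ℂ} (hz : z ∈ Disc) :
    holExt f z = (f : C(Disc, ℂ)) ⟨z, hz⟩ :=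
  Subtype.val_injective.extend_apply (f : C(Disc, ℂ)) 0 ⟨z, hz⟩

theorem differentiableOn_holExt (f : Hol) : DifferentiableOn ℂ (holExt f) Disc := by
  obtain ⟨F, hF, hfF⟩ := f.2
  exact hF.congr fun z hz => (holExt_apply f hz).trans (hfF ⟨z, hz⟩)

theorem analyticAt_holExt (f : Hol) {z : ℂ} (hz : z ∈ Disc) : AnalyticAt ℂ (holExt f) z :=
  (differentiableOn_holExt f).analyticAt (Metric.isOpen_ball.mem_nhds hz)

theorem holExt_sub (f g : Hol) : holExt (f - g) = holExt f - holExt g :=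
  map_sub holExt f g

theorem holExt_compHol {φ : ℂ → ℂ} (hφ : IsHolSelfMap φ) (f : Hol) {z : ℂ} (hz : z ∈ Disc) :
    holExt (compHol hφ f) z = holExt f (φ z) := by
  rw [holExt_apply _ hz, compHol_apply, holExt_apply _ (hφ.mapsTo hz)]

theorem eq_zero_of_holExt_eventually_eq_zero {f : Hol} {z : ℂ} (hz : z ∈ Disc)
    (hf : ∀ᶠ w in 𝓝 z, holExt f w = 0) : f = 0 := by
  have h := ((differentiableOn_holExt f).analyticOnNhd
    Metric.isOpen_ball).eqOn_zero_of_preconnected_of_eventuallyEq_zero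
      (convex_ball (0 : ℂ) 1).isPreconnected hz hf
  refine Subtype.ext (ContinuousMap.ext fun w => ?_)
  exact (holExt_apply f w.2).symm.trans (h w.2)

/-- The jet of order `n` at a point of the disc. -/
noncomputable def holJet {α : ℂ} (hα : α ∈ Disc) (n : ℕ) : Hol →ₗ[ℂ] (Fin n → ℂ) where
  toFun f k := iteratedDeriv k (holExt f) α
  map_add' f g := by
    ext k
    rw [map_add]
    exact iteratedDeriv_add (analyticAt_holExt f hα).contDiffAt (analyticAt_holExt g hα).contDiffAt
  map_smul' c f := by
    ext k
    rw [map_smul]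
    exact iteratedDeriv_const_smul_field c (holExt f)

variable {α : ℂ} (hα : α ∈ Disc)

theorem holJet_eq_zero_iff {n : ℕ} {f : Hol} :
    holJet hα n f = 0 ↔ (n : ℕ∞) ≤ analyticOrderAt (holExt f) α := by
  rw [natCast_le_analyticOrderAt_iff_iteratedDeriv_eq_zero (analyticAt_holExt f hα), funext_iff]
  exact ⟨fun h i hi => h ⟨i, hi⟩, fun h i => h i i.2⟩

variable {φ : ℂ → ℂ}

/-- Since `φ'(α) ≠ 0`, `φ` is a local biholomorphism fixing `α`. The equality gives both invariance
of the filtration and its converse `of_map_mem`. -/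
theorem analyticOrderAt_holExt_compHol (hφ : IsSchroderMap φ α) (f : Hol) :
    analyticOrderAt (holExt (compHol hφ.toIsHolSelfMap f)) α = analyticOrderAt (holExt f) α := by
  have hd := hφ.differentiableOn.analyticAt (Metric.isOpen_ball.mem_nhds hφ.mem_disc)
  have h := analyticOrderAt_comp_of_deriv_ne_zero (f := holExt f) hd hφ.deriv_ne_zero
  rw [hφ.fixed] at h
  rw [← h]
  apply analyticOrderAt_congr
  filter_upwards [Metric.isOpen_ball.mem_nhds hφ.mem_disc] with z hz
  exact holExt_compHol _ f hz

/-- With `f = (z - α)^n h` and `φ - α = (z - α) ψ`, the difference is `(z - α)^n (ψ^n (h ∘ φ) -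
φ'(α)^n h)`, whose second factor vanishes at `α` because `ψ(α) = φ'(α)`. -/
theorem le_analyticOrderAt_compHol_sub (hφ : IsSchroderMap φ α) {f : Hol} {n : ℕ}
    (hf : (n : ℕ∞) ≤ analyticOrderAt (holExt f) α) :
    ((n + 1 : ℕ) : ℕ∞) ≤ analyticOrderAt
      (holExt (compHol hφ.toIsHolSelfMap f - deriv φ α ^ n • f)) α := by
  have hα := hφ.mem_disc
  have hD : Disc ∈ 𝓝 α := Metric.isOpen_ball.mem_nhds hα
  have hφa := hφ.differentiableOn.analyticAt hD
  have hψa : AnalyticAt ℂ (dslope φ α) α :=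
    ((Complex.differentiableOn_dslope hD).2 hφ.differentiableOn).analyticAt hD
  obtain ⟨h, hh, hfh⟩ := (natCast_le_analyticOrderAt (analyticAt_holExt f hα)).1 hf
  set k : ℂ → ℂ := fun z => dslope φ α z ^ n * h (φ z) - deriv φ α ^ n * h z with hk
  have hka : AnalyticAt ℂ k α :=
    ((hψa.pow n).mul (AnalyticAt.comp (by rwa [hφ.fixed]) hφa)).sub (analyticAt_const.mul hh)
  have hk0 : k α = 0 := by simp [hk, hφ.fixed]
  have hk1 : 1 ≤ analyticOrderAt k α :=
    Order.one_le_iff_ne_zero.2 (hka.analyticOrderAt_ne_zero.2 hk0)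
  have heq : holExt (compHol hφ.toIsHolSelfMap f - deriv φ α ^ n • f) =ᶠ[𝓝 α]
      (· - α) ^ n * k := by
    have htend : Filter.Tendsto φ (𝓝 α) (𝓝 α) := by
      simpa only [ContinuousAt, hφ.fixed] using hφa.continuousAt
    have hfφ : ∀ᶠ z in 𝓝 α, holExt f (φ z) = (φ z - α) ^ n • h (φ z) := htend.eventually hfh
    filter_upwards [hD, hfh, hfφ] with z hz h₁ h₂
    have h₃ := sub_smul_dslope φ α z
    rw [hφ.fixed, smul_eq_mul] at h₃
    rw [holExt_sub, map_smul, Pi.sub_apply, Pi.smul_apply, holExt_compHol _ f hz, h₁, h₂, ← h₃]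
    simp only [hk, smul_eq_mul, Pi.mul_apply, Pi.pow_apply, mul_pow]
    ring
  rw [analyticOrderAt_congr heq, analyticOrderAt_mul (by fun_prop) hka,
    analyticOrderAt_centeredMonomial, Nat.cast_add, Nat.cast_one]
  gcongr

/-- The Schwarz lemma at a zero of order `n`. -/
theorem norm_holExt_le {f : Hol} {r C : ℝ} (hr : 0 < r) (hball : Metric.closedBall α r ⊆ Disc)
    (hC : ∀ z ∈ Metric.closedBall α r, ‖holExt f z‖ ≤ C) {n : ℕ}
    (hn : (n : ℕ∞) ≤ analyticOrderAt (holExt f) α) {z : ℂ} (hz : z ∈ Metric.closedBall α r) :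
    ‖holExt f z‖ ≤ C * (‖z - α‖ / r) ^ n := by
  have hα : α ∈ Disc := hball (Metric.mem_closedBall_self hr.le)
  -- A zero of order `m + 1` enters the Schwarz lemma as `o((w - α)^m)`, so `n = 0` is separate; so
  -- is the sphere, as that lemma covers only the open ball.
  rcases n with _ | m
  · simpa using hC z hz
  rcases (mem_closedBall_iff_norm.1 hz).eq_or_lt with hzr | hzr
  · rw [hzr, div_self hr.ne', one_pow, mul_one]
    exact hC z hz
  obtain ⟨h, hh, hfh⟩ := (natCast_le_analyticOrderAt (analyticAt_holExt f hα)).1 hn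
  have h0 : holExt f α = 0 := by simpa using hfh.self_of_nhds
  have key := Complex.dist_le_mul_div_pow_of_mapsTo_ball_of_isLittleO (n := m) (c := α) (R₂ := C)
    ((differentiableOn_holExt f).mono (Metric.ball_subset_closedBall.trans hball))
    (fun w hw => by
      rw [h0, mem_closedBall_zero_iff]
      exact hC w (Metric.ball_subset_closedBall hw)) ?_ (mem_ball_iff_norm.2 hzr)
  · simpa [h0, dist_eq_norm] using key
  · simp only [h0, sub_zero]
    have hlo : (fun w => (w - α) ^ (m + 1) • h w) =o[𝓝 α] fun w => (w - α) ^ m := by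
      have h₁ : (fun w => (w - α) * h w) =o[𝓝 α] fun _ => (1 : ℂ) := by
        rw [Asymptotics.isLittleO_one_iff]
        have : ContinuousAt (fun w => (w - α) * h w) α := by
          have := hh.continuousAt
          fun_prop
        simpa using this.tendsto
      have h₂ := (Asymptotics.isBigO_refl (fun w => (w - α) ^ m) (𝓝 α)).mul_isLittleO h₁
      simp only [mul_one] at h₂
      refine h₂.congr_left fun w => ?_
      rw [smul_eq_mul, pow_succ, mul_assoc]
    have hlo' : holExt f =o[𝓝 α] fun w => (w - α) ^ m :=
      hlo.congr' (hfh.mono fun w hw => hw.symm) Filter.EventuallyEq.rfl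
    simpa only [norm_pow] using hlo'.norm_right

end VanishingOrder

/-! ### The Koenigs filtration of the composition operator. -/

section CompRestrict

variable {φ : ℂ → ℂ} {α : ℂ} {X : Type*} [NormedAddCommGroup X] [NormedSpace ℂ X]

/-- The restriction of holomorphic functions to a compact ball in the disc. -/
noncomputable def holRestrict {r : ℝ} (hball : Metric.closedBall α r ⊆ Disc) :
    Hol →L[ℂ] C(Metric.closedBall α r, ℂ) where
  toFun f := (f : C(Disc, ℂ)).comp ⟨Set.inclusion hball, continuous_inclusion hball⟩
  map_add' _ _ := rfl
  map_smul' _ _ := rfl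
  cont := (ContinuousMap.continuous_precomp _).comp continuous_subtype_val

theorem holRestrict_apply {r : ℝ} (hball : Metric.closedBall α r ⊆ Disc) (f : Hol)
    (z : Metric.closedBall α r) : holRestrict hball f z = holExt f z :=
  (holExt_apply f (hball z.2)).symm

/-- Composition with a continuous map as an operator on continuous functions. -/
noncomputable def precompCLM {K : Type*} [TopologicalSpace K] [CompactSpace K] (g : C(K, K)) :
    C(K, ℂ) →L[ℂ] C(K, ℂ) where
  toFun f := f.comp g
  map_add' _ _ := rfl
  map_smul' _ _ := rfl
  cont := ContinuousMap.continuous_precomp g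

theorem norm_iteratedDeriv_holExt_le {r : ℝ} (hr : 0 < r) (hball : Metric.closedBall α r ⊆ Disc)
    (f : Hol) (k : ℕ) :
    ‖iteratedDeriv k (holExt f) α‖ ≤ k.factorial * ‖holRestrict hball f‖ / r ^ k := by
  refine Complex.norm_iteratedDeriv_le_of_forall_mem_sphere_norm_le k hr
    ((differentiableOn_holExt f).mono ?_).diffContOnCl fun z hz => ?_
  · rwa [closure_ball α hr.ne']
  · have h := (holRestrict hball f).norm_coe_le_norm ⟨z, Metric.sphere_subset_closedBall hz⟩
    rwa [holRestrict_apply] at h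

/-- Cauchy's estimates bound each jet coordinate by the sup norm on the ball; this makes the
filtration closed in `X`. -/
theorem continuous_holJet_comp (hα : α ∈ Disc) (ι : X →L[ℂ] Hol) {r : ℝ} (hr : 0 < r)
    (hball : Metric.closedBall α r ⊆ Disc) (n : ℕ) :
    Continuous ((holJet hα n).comp ι.toLinearMap) := by
  refine continuous_pi fun k => ?_
  refine AddMonoidHomClass.continuous_of_bound
    ((LinearMap.proj k).comp ((holJet hα n).comp ι.toLinearMap))
    ((k : ℕ).factorial * ‖(holRestrict hball).comp ι‖ / r ^ (k : ℕ)) fun x => ?_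
  refine (norm_iteratedDeriv_holExt_le hr hball (ι x) k).trans ?_
  rw [div_mul_eq_mul_div, mul_assoc]
  have := ((holRestrict hball).comp ι).le_opNorm x
  gcongr
  exact this

/-- The filtration of `X` by the order of vanishing at the fixed point. -/
theorem isKoenigsFiltration [CompleteSpace X] (hφ : IsSchroderMap φ α) (ι : X →L[ℂ] Hol)
    (hι : Function.Injective ι) (hinv : IsCompInvariant hφ.toIsHolSelfMap ι) :
    ∃ (r ρ : ℝ) (S : C(Metric.closedBall α r, ℂ) →L[ℂ] C(Metric.closedBall α r, ℂ))
      (j : X →L[ℂ] C(Metric.closedBall α r, ℂ)),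
      IsKoenigsFiltration (compRestrict hφ.toIsHolSelfMap ι hι hinv) S j (deriv φ α) ρ
        fun n => ((holJet hφ.mem_disc n).comp ι.toLinearMap).ker := by
  have hα := hφ.mem_disc
  obtain ⟨ρ, r, hρ, hρ1, hr, hball, hφr⟩ := hφ.exists_contracting_closedBall
  have hmaps : MapsTo φ (Metric.closedBall α r) (Metric.closedBall α r) := fun z hz => by
    rw [mem_closedBall_iff_norm] at *
    exact (hφr z (mem_closedBall_iff_norm.2 hz)).trans
      ((mul_le_of_le_one_left (norm_nonneg _) hρ1.le).trans hz)
  have hcont : ContinuousOn φ (Metric.closedBall α r) :=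
    hφ.differentiableOn.continuousOn.mono hball
  set T := compRestrict hφ.toIsHolSelfMap ι hι hinv with hT
  have hTι : ∀ x, ι (T x) = compHol hφ.toIsHolSelfMap (ι x) := compRestrict_spec _ ι hι hinv
  have mem {n : ℕ} {x : X} : x ∈ ((holJet hα n).comp ι.toLinearMap).ker ↔
      (n : ℕ∞) ≤ analyticOrderAt (holExt (ι x)) α := holJet_eq_zero_iff hα
  have memT {n : ℕ} {x : X} : T x ∈ ((holJet hα n).comp ι.toLinearMap).ker ↔
      x ∈ ((holJet hα n).comp ι.toLinearMap).ker := by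
    rw [mem, mem, hTι, analyticOrderAt_holExt_compHol hφ]
  refine ⟨r, ρ, precompCLM ⟨hmaps.restrict, hcont.mapsToRestrict hmaps⟩,
    (holRestrict hball).comp ι, ?_⟩
  exact
  { injective := by
      rw [injective_iff_map_eq_zero]
      intro x hx
      refine hι ((eq_zero_of_holExt_eventually_eq_zero hα ?_).trans (map_zero ι).symm)
      filter_upwards [Metric.closedBall_mem_nhds α hr] with z hz
      have h := holRestrict_apply hball (ι x) ⟨z, hz⟩
      rw [← h]
      exact congrArg (fun f : C(Metric.closedBall α r, ℂ) => f ⟨z, hz⟩) hx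
    intertwine := fun x => by
      simp only [ContinuousLinearMap.comp_apply, hTι]
      rfl
    rho_pos := hρ
    rho_lt_one := hρ1
    pow_injective := hφ.pow_deriv_injective
    zero := eq_top_iff.2 fun x _ => mem.2 (by simp)
    antitone := fun m n hmn x hx => mem.2 ((Nat.cast_le.2 hmn).trans (mem.1 hx))
    isClosed := fun n => isClosed_singleton.preimage (continuous_holJet_comp hα ι hr hball n)
    map_mem := fun n x hx => memT.2 hx
    of_map_mem := fun n x hx => memT.1 hx
    sub_mem := fun n x hx => by
      have h := le_analyticOrderAt_compHol_sub hφ (mem.1 hx)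
      rw [mem, map_sub, map_smul, hTι]
      exact h
    exists_ker_le := fun n => ⟨_, le_rfl⟩
    norm_le := fun n x hx => by
      have hC : ∀ z ∈ Metric.closedBall α r, ‖holExt (ι x) z‖ ≤ ‖holRestrict hball (ι x)‖ :=
        fun z hz => by
          have h := (holRestrict hball (ι x)).norm_coe_le_norm ⟨z, hz⟩
          rwa [holRestrict_apply] at h
      simp only [ContinuousLinearMap.comp_apply, hTι]
      refine (ContinuousMap.norm_le _ (by positivity)).2 fun z => ?_
      rw [holRestrict_apply, holExt_compHol _ _ (hball z.2)]
      -- The Schwarz lemma is applied at `φ z`, where `|φ z - α| / r ≤ ρ`.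
      refine (norm_holExt_le hr hball hC (mem.1 hx) (hmaps z.2)).trans ?_
      rw [mul_comm]
      gcongr
      rw [div_le_iff₀ hr]
      exact (hφr z z.2).trans (by gcongr; exact mem_closedBall_iff_norm.1 z.2) }

end CompRestrict

theorem theorem5p8 {φ : ℂ → ℂ} {α : ℂ} (hφ : IsSchroderMap φ α)
    {X : Type*} [NormedAddCommGroup X] [NormedSpace ℂ X] [CompleteSpace X]
    (hdim : ¬ FiniteDimensional ℂ X)
    (ι : X →L[ℂ] Hol) (hι : Function.Injective ι)
    (hinv : IsCompInvariant hφ.toIsHolSelfMap ι)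
    (T : X →L[ℂ] X) (hT : T = compRestrict hφ.toIsHolSelfMap ι hι hinv) :
    (0 : ℂ) ∈ spectrum ℂ T ∧
    spectrum ℂ T = connectedComponentIn (spectrum ℂ T) 0 ∪
      {μ : ℂ | ∃ n : ℕ, μ = deriv φ α ^ n ∧ IsIsolatedPt (spectrum ℂ T) (deriv φ α ^ n)} ∧
    essSpectrum T = connectedComponentIn (spectrum ℂ T) 0 := by
  obtain ⟨r, ρ, S, j, h⟩ := isKoenigsFiltration hφ ι hι hinv
  subst hT
  exact h.spectrum_eq hdim
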